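/- Let $n \ge 1$ be an integer, let $\lambda > 0$ and $\mu > 0$ be real numbers, put $R = \lambda/\mu$, and assume $1 \le R < n$. Let $X = \{X(t), t \ge 0\}$ be the number of customers in the Erlang-C ($M/M/n$) system with arrival rate $\lambda$ and service rate $\mu$, that is, the continuous-time Markov chain on $\mathbb{Z}_+ = \{0, 1, 2, \dots\}$ that jumps from $k$ to $k+1$ at rate $\lambda$ and from $k$ to $k-1$ at rate $\mu\min(k,n)$. Then $X$ has a unique stationary distribution. Let $X(\infty)$ be a random variable with this distribution, and let $\tilde X(\infty) = (X(\infty) - R)/\sqrt{R}$. Write $a^- = \max(-a, 0)$, and put $$\zeta = \frac{R-n}{\sqrt R}, \qquad b(x) = \big[(x+\zeta)^- - \zeta^-\big]\mu .$$ Then there is a normalizing constant $\kappa > 0$ for which $$\nu(x) = \kappa \exp\Big(\frac1\mu \int_0^x b(y)\,dy\Big), \qquad x \in \mathbb{R},$$ is a probability density. Let $Y(\infty)$ be a random variable with density $\nu$. Then $$d_K(\tilde X(\infty), Y(\infty)) = \sup_{a \in \mathbb{R}} \big|\mathbb{P}(\tilde X(\infty) \le a) - \mathbb{P}(Y(\infty)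 \le a)\big| \le \frac{188}{\sqrt R}.$$ -/

import Mathlib

open MeasureTheory Set
open scoped BoundedContinuousFunction

noncomputable section

namespace ErlangC

/-- Departure rate in state `k`: each of the `min k n` busy servers works at rate `mu`. -/
def departureRate (mu : ℝ) (n k : ℕ) : ℝ := mu * (min k n : ℕ)

/-- The action of the generator of the customer-count process on a function `f` of the state:
`k → k + 1` at rate `lam` and `k → k - 1` at rate `departureRate mu n k`, which is `0` at `k = 0`. -/
def generatorFun (lam mu : ℝ) (n : ℕ) (f : ℕ → ℝ) (k : ℕ) : ℝ :=
  lam * (f (k + 1) - f k) + departureRate mu n k * (f (k - 1) - f k)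

theorem abs_generatorFun_le (lam mu : ℝ) (n : ℕ) (f : ℕ →ᵇ ℝ) (k : ℕ) :
    |generatorFun lam mu n f k| ≤ 2 * (|lam| + |mu| * n) * ‖f‖ := by
  have h (i j : ℕ) : |f i - f j| ≤ 2 * ‖f‖ := by
    have := f.dist_le_two_norm i j
    rwa [Real.dist_eq] at this
  have hd : |departureRate mu n k| ≤ |mu| * n := by
    unfold departureRate
    rw [abs_mul, abs_of_nonneg (Nat.cast_nonneg (α := ℝ) (min k n))]
    gcongr
    exact min_le_right k n
  unfold generatorFun
  calc |lam * (f (k + 1) - f k) + departureRate mu n k * (f (k - 1) - f k)|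
      ≤ |lam| * |f (k + 1) - f k| + |departureRate mu n k| * |f (k - 1) - f k| := by
        rw [← abs_mul, ← abs_mul]
        exact abs_add_le _ _
    _ ≤ |lam| * (2 * ‖f‖) + (|mu| * n) * (2 * ‖f‖) := by
        gcongr
        · exact h _ _
        · exact h _ _
    _ = 2 * (|lam| + |mu| * n) * ‖f‖ := by ring

/-- The generator as a bounded operator on the space `ℕ →ᵇ ℝ` of bounded functions on `ℕ` with
the sup norm (the transition rates are bounded by `lam + n * mu`). -/
def generator (lam mu : ℝ) (n : ℕ) : (ℕ →ᵇ ℝ) →L[ℝ] (ℕ →ᵇ ℝ) :=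
  LinearMap.mkContinuous
    { toFun := fun f => BoundedContinuousFunction.ofNormedAddCommGroupDiscrete
        (generatorFun lam mu n f) (2 * (|lam| + |mu| * n) * ‖f‖)
        (abs_generatorFun_le lam mu n f)
      map_add' := fun f g => by
        ext k
        simp [generatorFun]
        ring
      map_smul' := fun c f => by
        ext k
        simp [generatorFun]
        ring }
    (2 * (|lam| + |mu| * n))
    (fun f => BoundedContinuousFunction.norm_ofNormedAddCommGroup_le _ (by positivity)
      (abs_generatorFun_le lam mu n f))

/-- The semigroup `exp (t A)` of a bounded operator `A` on a normed space. -/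
def expSemigroup {E : Type*} [NormedAddCommGroup E] [NormedSpace ℝ E] (A : E →L[ℝ] E) (t : ℝ) :
    E →L[ℝ] E :=
  NormedSpace.exp (t • A)

/-- The transition semigroup `exp (t G)` of the continuous-time Markov chain with (bounded)
generator `G`. -/
def semigroup (lam mu : ℝ) (n : ℕ) (t : ℝ) : (ℕ →ᵇ ℝ) →L[ℝ] (ℕ →ᵇ ℝ) :=
  expSemigroup (generator lam mu n) t

/-- The indicator function of the state `j`. -/
def stateIndicator (j : ℕ) : ℕ →ᵇ ℝ :=
  BoundedContinuousFunction.ofNormedAddCommGroupDiscrete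
    (fun i => if i = j then (1 : ℝ) else 0) 1 (fun i => by split_ifs <;> simp)

/-- The transition probability `P (X t = j | X 0 = i)`. -/
def transitionProb (lam mu : ℝ) (n : ℕ) (t : ℝ) (i j : ℕ) : ℝ :=
  semigroup lam mu n t (stateIndicator j) i

/-- `π` is a stationary distribution of the customer-count chain: a probability measure on `ℕ`
that is preserved by the transition probabilities at every time `t ≥ 0`. -/
structure IsStationary (lam mu : ℝ) (n : ℕ) (π : Measure ℕ) : Prop where
  isProbabilityMeasure : IsProbabilityMeasure π
  invariant : ∀ t : ℝ, 0 ≤ t → ∀ j : ℕ,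
    HasSum (fun i : ℕ => π.real {i} * transitionProb lam mu n t i j) (π.real {j})

/-- The offered load `R = λ / μ`. -/
def offeredLoad (lam mu : ℝ) : ℝ := lam / mu

/-- The law of `(X - R) / √R` when `X` has law `π`. -/
def scaledLaw (lam mu : ℝ) (π : Measure ℕ) : Measure ℝ :=
  π.map (fun k : ℕ => ((k : ℝ) - offeredLoad lam mu) / √(offeredLoad lam mu))

/-- `ζ = (R - n) / √R`. -/
def zeta (lam mu : ℝ) (n : ℕ) : ℝ := (offeredLoad lam mu - n) / √(offeredLoad lam mu)

/-- The drift `b(x) = ((x + ζ)⁻ - ζ⁻) μ`, where `a⁻ = max (-a) 0`. -/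
def drift (lam mu : ℝ) (n : ℕ) (x : ℝ) : ℝ :=
  (max (-(x + zeta lam mu n)) 0 - max (-zeta lam mu n) 0) * mu

/-- The unnormalized density `exp ((1/μ) ∫₀ˣ b(y) dy)`. -/
def weight (lam mu : ℝ) (n : ℕ) (x : ℝ) : ℝ :=
  Real.exp (1 / mu * ∫ y in (0 : ℝ)..x, drift lam mu n y)

/-- The density `κ exp ((1/μ) ∫₀ˣ b(y) dy)`, with `κ` the reciprocal of the total weight. -/
def density (lam mu : ℝ) (n : ℕ) (x : ℝ) : ℝ :=
  (∫ y, weight lam mu n y)⁻¹ * weight lam mu n x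

/-- The law of `Y(∞)`. -/
def diffusionLaw (lam mu : ℝ) (n : ℕ) : Measure ℝ :=
  volume.withDensity (fun x => ENNReal.ofReal (density lam mu n x))

/-- The Kolmogorov distance between two probability measures on `ℝ`, that is, the supremum of
`|E h(U) - E h(V)|` over the indicator functions `h` of the half-lines `(-∞, a]`. -/
def kolmogorovDist (P Q : Measure ℝ) : ℝ :=
  ⨆ a : ℝ, |P.real (Iic a) - Q.real (Iic a)|

end ErlangC

end

noncomputable section

namespace ErlangC

open Filter Topology

/-! Stein's method with a first-order equation. Let `β = unitDrift s` with s = -ζ, and let G be the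
distribution function of Y(∞). The equation f' + βf = 1_{(-∞,a]} - G(a) has an explicit solution f,
`steinSolution s a`. Detailed balance for the chain gives E[R(g(X+1) - g(X)) + (R - min(X,n)) g(X)]
= 0 for bounded g (`IsBalanced.integral_stein`). On the scaled grid of mesh δ = 1/√R, β equals (R -
min(k,n))/√R exactly, so taking g = f yields E[(f(x+δ) - f(x))/δ + β(x)f(x)] = 0 at the scaled state
x. Hence P(x ≤ a) - G(a) is the mean of the Taylor error f'(x) - (f(x+δ) - f(x))/δ.

Mills-ratio bounds give |βf| ≤ 1, so f is 2-Lipschitz, and f ≤ 9 left of s, uniformly in s. The kink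
s of β is a grid point, so a step that does not straddle a has error at most δ(9 + 2|β(x)|); the one
step that may straddle a has error at most 4 (`abs_steinError_le`). Two further test functions in
the same identity give E|β| ≤ 1 and π{j} ≤ δ. The total is (9 + 2 + 4)/√R = 15/√R.

Invariance under the semigroup is equivalent to detailed balance, a one-step recursion whose
solution is summable when R < n; this gives existence and uniqueness. -/

/-! ### The unnormalized density: bounds, tails, integrability. -/

/-- The drift of the diffusion in units of the service rate, with `s = -ζ`. -/
def unitDrift (s x : ℝ) : ℝ := max (-x) (-s)

/-- The unnormalized density with logarithmic derivative `unitDrift s`. -/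
def unitWeight (s x : ℝ) : ℝ := Real.exp (∫ y in (0 : ℝ)..x, unitDrift s y)

theorem continuous_unitDrift (s : ℝ) : Continuous (unitDrift s) := by
  unfold unitDrift; fun_prop

theorem antitone_unitDrift (s : ℝ) : Antitone (unitDrift s) := fun x y h => by
  unfold unitDrift; gcongr

theorem unitDrift_of_le {s x : ℝ} (h : x ≤ s) : unitDrift s x = -x :=
  max_eq_left (by linarith)

theorem unitDrift_of_ge {s x : ℝ} (h : s ≤ x) : unitDrift s x = -s :=
  max_eq_right (by linarith)

theorem unitWeight_pos (s x : ℝ) : 0 < unitWeight s x := Real.exp_pos _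

theorem hasDerivAt_unitWeight (s x : ℝ) :
    HasDerivAt (unitWeight s) (unitDrift s x * unitWeight s x) x := by
  have h := ((continuous_unitDrift s).integral_hasStrictDerivAt 0 x).hasDerivAt.exp
  rw [mul_comm]
  exact h

theorem continuous_unitWeight (s : ℝ) : Continuous (unitWeight s) :=
  continuous_iff_continuousAt.2 fun x => (hasDerivAt_unitWeight s x).continuousAt

theorem unitWeight_zero (s : ℝ) : unitWeight s 0 = 1 := by simp [unitWeight]

/-- The derivative is `unitDrift s x + c` times a positive function, and the drift is antitone, so
its sign at `x₀` persists to the right. Choices of `c` give both the bound by 1 and the exponential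
tails. -/
theorem antitoneOn_unitWeight_mul_exp (s : ℝ) {c x₀ : ℝ} (h : unitDrift s x₀ ≤ -c) :
    AntitoneOn (fun x => unitWeight s x * Real.exp (c * x)) (Ici x₀) := by
  have hd (x : ℝ) : HasDerivAt (fun x => unitWeight s x * Real.exp (c * x))
      ((unitDrift s x + c) * (unitWeight s x * Real.exp (c * x))) x := by
    have := (hasDerivAt_unitWeight s x).mul (((hasDerivAt_id x).const_mul c).exp)
    refine this.congr_deriv ?_
    simp only [id]; ring
  refine antitoneOn_of_hasDerivWithinAt_nonpos (convex_Ici x₀)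
    (fun x _ => (hd x).continuousAt.continuousWithinAt)
    (fun x _ => (hd x).hasDerivWithinAt) fun x hx => ?_
  rw [interior_Ici] at hx
  have := antitone_unitDrift s hx.le
  have h2 : 0 < unitWeight s x * Real.exp (c * x) := mul_pos (unitWeight_pos s x) (Real.exp_pos _)
  nlinarith

theorem monotoneOn_unitWeight_mul_exp (s : ℝ) {c x₀ : ℝ} (h : -c ≤ unitDrift s x₀) :
    MonotoneOn (fun x => unitWeight s x * Real.exp (c * x)) (Iic x₀) := by
  have hd (x : ℝ) : HasDerivAt (fun x => unitWeight s x * Real.exp (c * x))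
      ((unitDrift s x + c) * (unitWeight s x * Real.exp (c * x))) x := by
    have := (hasDerivAt_unitWeight s x).mul (((hasDerivAt_id x).const_mul c).exp)
    refine this.congr_deriv ?_
    simp only [id]; ring
  refine monotoneOn_of_hasDerivWithinAt_nonneg (convex_Iic x₀)
    (fun x _ => (hd x).continuousAt.continuousWithinAt)
    (fun x _ => (hd x).hasDerivWithinAt) fun x hx => ?_
  rw [interior_Iic] at hx
  have := antitone_unitDrift s hx.le
  have h2 : 0 < unitWeight s x * Real.exp (c * x) := mul_pos (unitWeight_pos s x) (Real.exp_pos _)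
  nlinarith

theorem unitWeight_le_one {s : ℝ} (hs : 0 < s) (x : ℝ) : unitWeight s x ≤ 1 := by
  -- The drift vanishes at 0, so the comparison applies on both sides with c = 0.
  have h0 : unitDrift s 0 = -0 := unitDrift_of_le hs.le
  rcases le_total 0 x with h | h
  · simpa [unitWeight_zero] using
      antitoneOn_unitWeight_mul_exp s h0.le self_mem_Ici h h
  · simpa [unitWeight_zero] using
      monotoneOn_unitWeight_mul_exp s h0.ge h self_mem_Iic h

theorem exp_neg_one_le_unitWeight {s : ℝ} (hs : 0 < s) {x : ℝ} (h : |x| ≤ 1) :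
    Real.exp (-1) ≤ unitWeight s x := by
  rw [abs_le] at h
  refine Real.exp_le_exp.2 ?_
  have hb : ‖∫ y in (0 : ℝ)..x, unitDrift s y‖ ≤ 1 * |x - 0| := by
    refine intervalIntegral.norm_integral_le_of_norm_le_const fun y hy => ?_
    have hy' : -1 ≤ y ∧ y ≤ 1 := by
      rw [mem_uIoc] at hy
      rcases hy with hy | hy <;> constructor <;> linarith [hy.1, hy.2, h.1, h.2]
    rw [Real.norm_eq_abs, abs_le]
    unfold unitDrift
    exact ⟨le_max_of_le_left (by linarith), max_le (by linarith) (by linarith)⟩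
  rw [Real.norm_eq_abs, sub_zero, one_mul] at hb
  have : |x| ≤ 1 := abs_le.2 h
  linarith [neg_abs_le (∫ y in (0 : ℝ)..x, unitDrift s y)]

theorem unitWeight_le_exp_of_ge {s x : ℝ} (hs : 0 < s) (h : s ≤ x) :
    unitWeight s x ≤ Real.exp (s * s) * Real.exp (-s * x) := by
  have h1 := antitoneOn_unitWeight_mul_exp s (c := s) (unitDrift_of_ge le_rfl).le
    self_mem_Ici h h
  have h2 := unitWeight_le_one hs s
  have h3 : unitWeight s x = unitWeight s x * Real.exp (s * x) * Real.exp (-s * x) := by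
    rw [mul_assoc, ← Real.exp_add]; simp
  rw [h3]
  gcongr
  exact h1.trans (mul_le_of_le_one_left (Real.exp_pos _).le h2)

theorem unitWeight_le_exp_of_le {s x : ℝ} (hs : 0 < s) (h : x ≤ -1) :
    unitWeight s x ≤ Real.exp 1 * Real.exp x := by
  -- The drift at -1 equals 1, whence the rate c = -1.
  have h1 := monotoneOn_unitWeight_mul_exp s (c := -1) (x₀ := -1)
    (by rw [unitDrift_of_le (by linarith)]) h self_mem_Iic h
  have h2 := unitWeight_le_one hs (-1)
  have h3 : unitWeight s x = unitWeight s x * Real.exp (-1 * x) * Real.exp x := by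
    rw [mul_assoc, ← Real.exp_add]; simp
  rw [h3]
  gcongr
  refine h1.trans ((mul_le_of_le_one_left (Real.exp_pos _).le h2).trans ?_)
  simp

theorem tendsto_unitWeight_atTop {s : ℝ} (hs : 0 < s) :
    Tendsto (unitWeight s) atTop (𝓝 0) := by
  have h : Tendsto (fun x => Real.exp (s * s) * Real.exp (-s * x)) atTop (𝓝 0) := by
    have : Tendsto (fun x => -s * x) atTop atBot :=
      tendsto_id.const_mul_atTop_of_neg (by linarith)
    simpa using (Real.tendsto_exp_atBot.comp this).const_mul (Real.exp (s * s))
  refine squeeze_zero' (Eventually.of_forall fun x => (unitWeight_pos s x).le) ?_ h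
  filter_upwards [eventually_ge_atTop s] with x hx using unitWeight_le_exp_of_ge hs hx

theorem tendsto_unitWeight_atBot {s : ℝ} (hs : 0 < s) :
    Tendsto (unitWeight s) atBot (𝓝 0) := by
  have h : Tendsto (fun x => Real.exp 1 * Real.exp x) atBot (𝓝 0) := by
    simpa using Real.tendsto_exp_atBot.const_mul (Real.exp 1)
  refine squeeze_zero' (Eventually.of_forall fun x => (unitWeight_pos s x).le) ?_ h
  filter_upwards [eventually_le_atBot (-1)] with x hx using unitWeight_le_exp_of_le hs hx

theorem integrable_unitWeight {s : ℝ} (hs : 0 < s) : Integrable (unitWeight s) := by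
  have hm {S : Set ℝ} : AEStronglyMeasurable (unitWeight s) (volume.restrict S) :=
    (continuous_unitWeight s).aestronglyMeasurable
  have h1 : IntegrableOn (unitWeight s) (Iic (-1)) := by
    refine Integrable.mono' ((integrableOn_exp_Iic (-1)).const_mul (Real.exp 1)) hm ?_
    filter_upwards [ae_restrict_mem measurableSet_Iic] with x hx
    rw [Real.norm_of_nonneg (unitWeight_pos s x).le]
    exact unitWeight_le_exp_of_le hs hx
  have h2 : IntegrableOn (unitWeight s) (Ioi s) := by
    refine Integrable.mono' ((integrableOn_exp_mul_Ioi (a := -s) (by linarith) s).const_mul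
      (Real.exp (s * s))) hm ?_
    filter_upwards [ae_restrict_mem measurableSet_Ioi] with x hx
    rw [Real.norm_of_nonneg (unitWeight_pos s x).le]
    exact unitWeight_le_exp_of_ge hs (le_of_lt hx)
  have h3 : IntegrableOn (unitWeight s) (Icc (-1) s) :=
    (continuous_unitWeight s).continuousOn.integrableOn_Icc
  rw [← integrableOn_univ]
  refine ((h1.union h3).union h2).mono_set fun x _ => ?_
  rcases le_total x (-1) with h | h
  · exact Or.inl (Or.inl h)
  · rcases le_or_gt x s with h' | h'
    · exact Or.inl (Or.inr ⟨h, h'⟩)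
    · exact Or.inr h'

/-! ### Masses of half-lines and Mills-ratio bounds. -/

/-- The unnormalized distribution function of the diffusion. -/
def lowerMass (s x : ℝ) : ℝ := ∫ y in Iic x, unitWeight s y

/-- The unnormalized tail of the diffusion. -/
def upperMass (s x : ℝ) : ℝ := ∫ y in Ioi x, unitWeight s y

/-- The total mass of the unnormalized density. -/
def totalMass (s : ℝ) : ℝ := ∫ y, unitWeight s y

theorem lowerMass_add_upperMass {s : ℝ} (hs : 0 < s) (x : ℝ) :
    lowerMass s x + upperMass s x = totalMass s :=
  intervalIntegral.integral_Iic_add_Ioi (integrable_unitWeight hs).integrableOn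
    (integrable_unitWeight hs).integrableOn

theorem lowerMass_nonneg (s x : ℝ) : 0 ≤ lowerMass s x :=
  integral_nonneg fun y => (unitWeight_pos s y).le

theorem upperMass_nonneg (s x : ℝ) : 0 ≤ upperMass s x :=
  integral_nonneg fun y => (unitWeight_pos s y).le

theorem totalMass_pos {s : ℝ} (hs : 0 < s) : 0 < totalMass s := by
  refine (integral_pos_iff_support_of_nonneg (fun y => (unitWeight_pos s y).le)
    (integrable_unitWeight hs)).2 ?_
  have : Function.support (unitWeight s) = univ :=
    Set.eq_univ_of_forall fun y => (unitWeight_pos s y).ne'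
  simp [this]

theorem lowerMass_sub {s : ℝ} (hs : 0 < s) (x y : ℝ) :
    lowerMass s y - lowerMass s x = ∫ t in x..y, unitWeight s t :=
  intervalIntegral.integral_Iic_sub_Iic (integrable_unitWeight hs).integrableOn
    (integrable_unitWeight hs).integrableOn

theorem monotone_lowerMass {s : ℝ} (hs : 0 < s) : Monotone (lowerMass s) := fun x y h => by
  have := lowerMass_sub hs x y
  have h2 := intervalIntegral.integral_nonneg (μ := volume) h (fun t _ => (unitWeight_pos s t).le)
  linarith

theorem antitone_upperMass {s : ℝ} (hs : 0 < s) : Antitone (upperMass s) := fun x y h => by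
  have := monotone_lowerMass hs h
  linarith [lowerMass_add_upperMass hs x, lowerMass_add_upperMass hs y]

theorem hasDerivAt_lowerMass {s : ℝ} (hs : 0 < s) (x : ℝ) :
    HasDerivAt (lowerMass s) (unitWeight s x) x := by
  have h := ((continuous_unitWeight s).integral_hasStrictDerivAt 0 x).hasDerivAt.const_add
    (lowerMass s 0)
  refine h.congr_of_eventuallyEq (Eventually.of_forall fun y => ?_)
  simp only
  linarith [lowerMass_sub hs 0 y]

theorem hasDerivAt_upperMass {s : ℝ} (hs : 0 < s) (x : ℝ) :
    HasDerivAt (upperMass s) (-unitWeight s x) x := by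
  refine ((hasDerivAt_lowerMass hs x).const_sub (totalMass s)).congr_of_eventuallyEq
    (Eventually.of_forall fun y => ?_)
  simp only
  linarith [lowerMass_add_upperMass hs y]

theorem tendsto_lowerMass_atTop {s : ℝ} (hs : 0 < s) :
    Tendsto (lowerMass s) atTop (𝓝 (totalMass s)) := by
  have h := (intervalIntegral_tendsto_integral_Ioi 0
    (integrable_unitWeight hs).integrableOn tendsto_id).const_add (lowerMass s 0)
  change Tendsto _ _ (𝓝 (lowerMass s 0 + upperMass s 0)) at h
  rw [lowerMass_add_upperMass hs] at h
  refine h.congr fun y => ?_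
  simp only [id]
  linarith [lowerMass_sub hs 0 y]

theorem tendsto_upperMass_atTop {s : ℝ} (hs : 0 < s) :
    Tendsto (upperMass s) atTop (𝓝 0) := by
  have h := (tendsto_lowerMass_atTop hs).const_sub (totalMass s)
  rw [sub_self] at h
  refine h.congr fun y => ?_
  linarith [lowerMass_add_upperMass hs y]

theorem tendsto_lowerMass_atBot {s : ℝ} (hs : 0 < s) :
    Tendsto (lowerMass s) atBot (𝓝 0) := by
  have h := (intervalIntegral_tendsto_integral_Iic 0
    (integrable_unitWeight hs).integrableOn tendsto_id).const_sub (lowerMass s 0)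
  change Tendsto _ _ (𝓝 (lowerMass s 0 - lowerMass s 0)) at h
  rw [sub_self] at h
  refine h.congr fun y => ?_
  simp only [id]
  linarith [lowerMass_sub hs y 0]

/-- Freeze c = β(x). To the left of x the drift is at least c, so the weight minus c times the lower
mass is nondecreasing there, and it tends to 0 at -∞. -/
theorem unitDrift_mul_lowerMass_le {s : ℝ} (hs : 0 < s) (x : ℝ) :
    unitDrift s x * lowerMass s x ≤ unitWeight s x := by
  set c := unitDrift s x
  have hd (y : ℝ) : HasDerivAt (fun y => unitWeight s y - c * lowerMass s y)
      (unitDrift s y * unitWeight s y - c * unitWeight s y) y :=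
    (hasDerivAt_unitWeight s y).sub ((hasDerivAt_lowerMass hs y).const_mul c)
  have hm : MonotoneOn (fun y => unitWeight s y - c * lowerMass s y) (Iic x) := by
    refine monotoneOn_of_hasDerivWithinAt_nonneg (convex_Iic x)
      (fun y _ => (hd y).continuousAt.continuousWithinAt)
      (fun y _ => (hd y).hasDerivWithinAt) fun y hy => ?_
    rw [interior_Iic] at hy
    have h1 : c ≤ unitDrift s y := antitone_unitDrift s hy.le
    nlinarith [unitWeight_pos s y]
  have hl : Tendsto (fun y => unitWeight s y - c * lowerMass s y) atBot (𝓝 0) := by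
    simpa using (tendsto_unitWeight_atBot hs).sub ((tendsto_lowerMass_atBot hs).const_mul c)
  have h0 : 0 ≤ unitWeight s x - c * lowerMass s x := by
    refine le_of_tendsto hl ?_
    filter_upwards [eventually_le_atBot x] with y hy using hm hy self_mem_Iic hy
  linarith

theorem neg_unitDrift_mul_upperMass_le {s : ℝ} (hs : 0 < s) (x : ℝ) :
    -unitDrift s x * upperMass s x ≤ unitWeight s x := by
  set c := unitDrift s x
  have hd (y : ℝ) : HasDerivAt (fun y => unitWeight s y + c * upperMass s y)
      (unitDrift s y * unitWeight s y + c * -unitWeight s y) y :=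
    (hasDerivAt_unitWeight s y).add ((hasDerivAt_upperMass hs y).const_mul c)
  have hm : AntitoneOn (fun y => unitWeight s y + c * upperMass s y) (Ici x) := by
    refine antitoneOn_of_hasDerivWithinAt_nonpos (convex_Ici x)
      (fun y _ => (hd y).continuousAt.continuousWithinAt)
      (fun y _ => (hd y).hasDerivWithinAt) fun y hy => ?_
    rw [interior_Ici] at hy
    have h1 : unitDrift s y ≤ c := antitone_unitDrift s hy.le
    nlinarith [unitWeight_pos s y]
  have hl : Tendsto (fun y => unitWeight s y + c * upperMass s y) atTop (𝓝 0) := by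
    simpa using (tendsto_unitWeight_atTop hs).add ((tendsto_upperMass_atTop hs).const_mul c)
  have h0 : 0 ≤ unitWeight s x + c * upperMass s x := by
    refine le_of_tendsto hl ?_
    filter_upwards [eventually_ge_atTop x] with y hy using hm self_mem_Ici hy hy
  linarith

/-- On `[-1, 1]` the inverse reversed hazard rate is bounded. -/
theorem lowerMass_le_of_abs_le_one {s : ℝ} (hs : 0 < s) {x : ℝ} (h : |x| ≤ 1) :
    lowerMass s x ≤ 9 * unitWeight s x := by
  have h1 := exp_neg_one_le_unitWeight hs h
  rw [abs_le] at h
  -- The drift at -1 is 1, so the mass below -1 is at most 1; the mass of [-1, x] is at most 2.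
  -- Dividing 3 by the lower bound 1/3 for the weight gives 9.
  have h2 := unitDrift_mul_lowerMass_le hs (-1)
  rw [unitDrift_of_le (by linarith)] at h2
  have h3 := unitWeight_le_one hs (-1)
  have h4 := lowerMass_sub hs (-1) x
  have h5 : ∫ t in (-1)..x, unitWeight s t ≤ ∫ t in (-1)..x, (1 : ℝ) :=
    intervalIntegral.integral_mono_on h.1 ((continuous_unitWeight s).intervalIntegrable _ _)
      (by simp) fun t _ => unitWeight_le_one hs t
  rw [intervalIntegral.integral_const, smul_eq_mul] at h5
  have h6 : (1 : ℝ) / 3 ≤ Real.exp (-1) := by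
    rw [Real.exp_neg, one_div]
    exact inv_anti₀ (Real.exp_pos 1) (by linarith [Real.exp_one_lt_d9])
  linarith [h.2]

/-! ### The Stein equation: bounds on its solution and its Taylor error. -/

/-- The solution of the Stein equation `f' + β f = 1_{(-∞, a]} - G(a)`. -/
def steinSolution (s a x : ℝ) : ℝ :=
  lowerMass s (min x a) * upperMass s (max x a) / (totalMass s * unitWeight s x)

variable {s : ℝ} (a : ℝ)

theorem steinSolution_of_le {x : ℝ} (h : x ≤ a) : steinSolution s a x =
    upperMass s a / totalMass s * (lowerMass s x / unitWeight s x) := by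
  rw [steinSolution, min_eq_left h, max_eq_right h]
  ring

theorem steinSolution_of_ge {x : ℝ} (h : a ≤ x) : steinSolution s a x =
    lowerMass s a / totalMass s * (upperMass s x / unitWeight s x) := by
  rw [steinSolution, min_eq_right h, max_eq_left h]
  ring

theorem steinSolution_nonneg (hs : 0 < s) (x : ℝ) : 0 ≤ steinSolution s a x :=
  div_nonneg (mul_nonneg (lowerMass_nonneg _ _) (upperMass_nonneg _ _))
    (mul_pos (totalMass_pos hs) (unitWeight_pos s x)).le

theorem steinSolution_le_lower (hs : 0 < s) (x : ℝ) :
    steinSolution s a x ≤ lowerMass s x / unitWeight s x := by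
  rw [steinSolution, div_le_div_iff₀ (mul_pos (totalMass_pos hs) (unitWeight_pos s x))
    (unitWeight_pos s x), ← mul_assoc]
  refine mul_le_mul_of_nonneg_right ?_ (unitWeight_pos s x).le
  refine mul_le_mul (monotone_lowerMass hs (min_le_left _ _)) ?_ (upperMass_nonneg _ _)
    (lowerMass_nonneg _ _)
  linarith [lowerMass_add_upperMass hs (max x a), lowerMass_nonneg s (max x a)]

theorem steinSolution_le_upper (hs : 0 < s) (x : ℝ) :
    steinSolution s a x ≤ upperMass s x / unitWeight s x := by
  rw [steinSolution, div_le_div_iff₀ (mul_pos (totalMass_pos hs) (unitWeight_pos s x))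
    (unitWeight_pos s x), ← mul_assoc, mul_comm (upperMass s x)]
  refine mul_le_mul_of_nonneg_right ?_ (unitWeight_pos s x).le
  refine mul_le_mul ?_ (antitone_upperMass hs (le_max_left _ _)) (upperMass_nonneg _ _)
    (totalMass_pos hs).le
  linarith [lowerMass_add_upperMass hs (min x a), upperMass_nonneg s (min x a)]

/-- Only a positive drift matters, and there the lower Mills ratio controls f. The companion lower
bound uses the upper ratio where the drift is negative. -/
theorem unitDrift_mul_steinSolution_le (hs : 0 < s) (x : ℝ) :
    unitDrift s x * steinSolution s a x ≤ 1 := by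
  rcases le_total (unitDrift s x) 0 with h | h
  · nlinarith [steinSolution_nonneg a hs x]
  · refine (mul_le_mul_of_nonneg_left (steinSolution_le_lower a hs x) h).trans ?_
    rw [← mul_div_assoc, div_le_one (unitWeight_pos s x)]
    exact unitDrift_mul_lowerMass_le hs x

theorem neg_one_le_unitDrift_mul_steinSolution (hs : 0 < s) (x : ℝ) :
    -1 ≤ unitDrift s x * steinSolution s a x := by
  rcases le_total 0 (unitDrift s x) with h | h
  · nlinarith [steinSolution_nonneg a hs x]
  · have h1 := mul_le_mul_of_nonneg_left (steinSolution_le_upper a hs x) (neg_nonneg.2 h)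
    rw [← mul_div_assoc] at h1
    have h2 := (div_le_one (unitWeight_pos s x)).2 (neg_unitDrift_mul_upperMass_le hs x)
    linarith

/-- Left of s the drift is -x, so |βf| ≤ 1 gives f ≤ 1 once |x| ≥ 1; the Mills ratio covers [-1, 1].
The bound does not depend on s. -/
theorem steinSolution_le_nine (hs : 0 < s) {x : ℝ} (hx : x ≤ s) : steinSolution s a x ≤ 9 := by
  have h0 := steinSolution_nonneg a hs x
  have hb := unitDrift_of_le hx
  rcases le_total x (-1) with h | h
  · have := unitDrift_mul_steinSolution_le a hs x
    rw [hb] at this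
    nlinarith
  · rcases le_total x 1 with h' | h'
    · refine (steinSolution_le_lower a hs x).trans ?_
      rw [div_le_iff₀ (unitWeight_pos s x)]
      exact lowerMass_le_of_abs_le_one hs (abs_le.2 ⟨h, h'⟩)
    · have := neg_one_le_unitDrift_mul_steinSolution a hs x
      rw [hb] at this
      nlinarith

/-- This bound degenerates as s → 0. It serves only to make f a bounded test function and never
enters the final constant. -/
theorem steinSolution_le (hs : 0 < s) (x : ℝ) : steinSolution s a x ≤ max 9 (1 / s) := by
  rcases le_total x s with h | h
  · exact le_max_of_le_left (steinSolution_le_nine a hs h)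
  · refine le_max_of_le_right ?_
    have := neg_one_le_unitDrift_mul_steinSolution a hs x
    rw [unitDrift_of_ge h] at this
    rw [le_div_iff₀ hs]
    linarith

/-- The normalized distribution function of the diffusion. -/
def limitCDF (s a : ℝ) : ℝ := lowerMass s a / totalMass s

theorem limitCDF_nonneg (hs : 0 < s) : 0 ≤ limitCDF s a :=
  div_nonneg (lowerMass_nonneg _ _) (totalMass_pos hs).le

theorem limitCDF_le_one (hs : 0 < s) : limitCDF s a ≤ 1 := by
  refine (div_le_one (totalMass_pos hs)).2 ?_
  linarith [lowerMass_add_upperMass hs a, upperMass_nonneg s a]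

theorem one_sub_limitCDF (hs : 0 < s) : 1 - limitCDF s a = upperMass s a / totalMass s := by
  rw [limitCDF, eq_div_iff (totalMass_pos hs).ne', sub_mul,
    div_mul_cancel₀ _ (totalMass_pos hs).ne']
  linarith [lowerMass_add_upperMass hs a]

theorem hasDerivAt_lowerMass_div (hs : 0 < s) (x : ℝ) :
    HasDerivAt (fun x => lowerMass s x / unitWeight s x)
      (1 - unitDrift s x * (lowerMass s x / unitWeight s x)) x := by
  refine ((hasDerivAt_lowerMass hs x).div (hasDerivAt_unitWeight s x)
    (unitWeight_pos s x).ne').congr_deriv ?_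
  have := (unitWeight_pos s x).ne'
  field_simp

theorem hasDerivAt_upperMass_div (hs : 0 < s) (x : ℝ) :
    HasDerivAt (fun x => upperMass s x / unitWeight s x)
      (-1 - unitDrift s x * (upperMass s x / unitWeight s x)) x := by
  refine ((hasDerivAt_upperMass hs x).div (hasDerivAt_unitWeight s x)
    (unitWeight_pos s x).ne').congr_deriv ?_
  have := (unitWeight_pos s x).ne'
  field_simp

/-- The derivative of f jumps at a, so the Stein equation is used on each closed half-line with a
constant indicator value, 1 here and 0 on `Ici a`. -/
theorem hasDerivWithinAt_steinSolution_Iic (hs : 0 < s) {x : ℝ} (h : x ≤ a) :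
    HasDerivWithinAt (steinSolution s a)
      (1 - limitCDF s a - unitDrift s x * steinSolution s a x) (Iic a) x := by
  rw [steinSolution_of_le a h]
  refine (((hasDerivAt_lowerMass_div hs x).const_mul
    (upperMass s a / totalMass s)).hasDerivWithinAt.congr
    (fun y hy => steinSolution_of_le a hy) (steinSolution_of_le a h)).congr_deriv ?_
  rw [one_sub_limitCDF a hs]
  ring

theorem hasDerivWithinAt_steinSolution_Ici (hs : 0 < s) {x : ℝ} (h : a ≤ x) :
    HasDerivWithinAt (steinSolution s a)
      (0 - limitCDF s a - unitDrift s x * steinSolution s a x) (Ici a) x := by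
  rw [steinSolution_of_ge a h]
  refine (((hasDerivAt_upperMass_div hs x).const_mul
    (lowerMass s a / totalMass s)).hasDerivWithinAt.congr
    (fun y hy => steinSolution_of_ge a hy) (steinSolution_of_ge a h)).congr_deriv ?_
  rw [limitCDF]
  ring

theorem abs_steinDeriv_le (hs : 0 < s) {i : ℝ} (h0 : 0 ≤ i) (h1 : i ≤ 1) (x : ℝ) :
    |i - limitCDF s a - unitDrift s x * steinSolution s a x| ≤ 2 := by
  rw [abs_le]
  constructor <;> linarith [limitCDF_nonneg a hs, limitCDF_le_one a hs,
    unitDrift_mul_steinSolution_le a hs x, neg_one_le_unitDrift_mul_steinSolution a hs x]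

theorem abs_steinSolution_sub_le_of_subset (hs : 0 < s) {x y : ℝ} (hxy : x ≤ y)
    (h : y ≤ a ∨ a ≤ x) : |steinSolution s a y - steinSolution s a x| ≤ 2 * (y - x) := by
  rw [← Real.norm_eq_abs, ← abs_of_nonneg (sub_nonneg.2 hxy), ← Real.norm_eq_abs (y - x)]
  rcases h with h | h
  · exact (convex_Iic a).norm_image_sub_le_of_norm_hasDerivWithin_le
      (fun z hz => hasDerivWithinAt_steinSolution_Iic a hs hz)
      (fun z _ => abs_steinDeriv_le a hs zero_le_one le_rfl z) (hxy.trans h) h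
  · exact (convex_Ici a).norm_image_sub_le_of_norm_hasDerivWithin_le
      (fun z hz => hasDerivWithinAt_steinSolution_Ici a hs hz)
      (fun z _ => abs_steinDeriv_le a hs le_rfl zero_le_one z) h (h.trans hxy)

theorem abs_steinSolution_sub_le (hs : 0 < s) {x y : ℝ} (hxy : x ≤ y) :
    |steinSolution s a y - steinSolution s a x| ≤ 2 * (y - x) := by
  rcases le_total y a with h | h
  · exact abs_steinSolution_sub_le_of_subset a hs hxy (Or.inl h)
  · rcases le_total a x with h' | h'
    · exact abs_steinSolution_sub_le_of_subset a hs hxy (Or.inr h')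
    · have h1 := abs_steinSolution_sub_le_of_subset a hs h (Or.inr le_rfl)
      have h2 := abs_steinSolution_sub_le_of_subset a hs h' (Or.inl le_rfl)
      have h3 := abs_sub_le (steinSolution s a y) (steinSolution s a a) (steinSolution s a x)
      linarith

/-- Modulus of continuity of `β f` to the right of a point `x` whose step `[x, x + δ]` does not
straddle the kink of `β`. -/
theorem abs_unitDrift_mul_steinSolution_sub_le (hs : 0 < s) {x y δ : ℝ} (hxy : x ≤ y)
    (hy : y ≤ x + δ) (hx : x + δ ≤ s ∨ s ≤ x) :
    |unitDrift s y * steinSolution s a y - unitDrift s x * steinSolution s a x| ≤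
      δ * (9 + 2 * |unitDrift s x|) := by
  have h1 : |(unitDrift s y - unitDrift s x) * steinSolution s a y| ≤ δ * 9 := by
    rcases hx with h | h
    · rw [unitDrift_of_le (hy.trans h), unitDrift_of_le (by linarith), abs_mul,
        abs_of_nonneg (steinSolution_nonneg a hs y)]
      refine mul_le_mul ?_ (steinSolution_le_nine a hs (hy.trans h))
        (steinSolution_nonneg a hs y) (by linarith)
      rw [abs_le]
      constructor <;> linarith
    -- Beyond s the drift is constant, so this term vanishes exactly where f has no bound uniform in
    -- s.
    · rw [unitDrift_of_ge h, unitDrift_of_ge (h.trans hxy)]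
      simp only [sub_self, zero_mul, abs_zero]
      linarith
  have h2 : |unitDrift s x * (steinSolution s a y - steinSolution s a x)| ≤
      δ * (2 * |unitDrift s x|) := by
    rw [abs_mul]
    have := abs_steinSolution_sub_le a hs hxy
    nlinarith [abs_nonneg (unitDrift s x)]
  calc _ = |(unitDrift s y - unitDrift s x) * steinSolution s a y +
        unitDrift s x * (steinSolution s a y - steinSolution s a x)| := by ring_nf
    _ ≤ _ := (abs_add_le _ _).trans (by linarith)

/-- Mean value inequality for f minus its linear part: the indicator is constant along the step, so
the derivative of the difference is β(x)f(x) - β(z)f(z), controlled by the preceding modulus of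
continuity. -/
theorem abs_steinSolution_taylor_le (hs : 0 < s) {x δ i : ℝ} (hδ : 0 ≤ δ)
    (hx : x + δ ≤ s ∨ s ≤ x) (hi : i = 1 ∧ x + δ ≤ a ∨ i = 0 ∧ a ≤ x) :
    |steinSolution s a (x + δ) - steinSolution s a x -
      (i - limitCDF s a - unitDrift s x * steinSolution s a x) * δ| ≤
      δ * (9 + 2 * |unitDrift s x|) * δ := by
  set c := i - limitCDF s a - unitDrift s x * steinSolution s a x with hc
  have hd (z : ℝ) (hz : z ∈ Icc x (x + δ)) : HasDerivWithinAt
      (fun z => steinSolution s a z - c * z)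
      (i - limitCDF s a - unitDrift s z * steinSolution s a z - c * 1) (Icc x (x + δ)) z := by
    refine HasDerivWithinAt.sub ?_ ((hasDerivWithinAt_id z _).const_mul c)
    rcases hi with ⟨rfl, h⟩ | ⟨rfl, h⟩
    · exact (hasDerivWithinAt_steinSolution_Iic a hs (hz.2.trans h)).mono
        fun w hw => hw.2.trans h
    · exact (hasDerivWithinAt_steinSolution_Ici a hs (h.trans hz.1)).mono
        fun w hw => h.trans hw.1
  have := (convex_Icc x (x + δ)).norm_image_sub_le_of_norm_hasDerivWithin_le hd
    (C := δ * (9 + 2 * |unitDrift s x|)) (fun z hz => ?_)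
    (left_mem_Icc.2 (by linarith)) (right_mem_Icc.2 (by linarith))
  · rw [Real.norm_eq_abs, Real.norm_eq_abs, add_sub_cancel_left, abs_of_nonneg hδ] at this
    convert this using 2
    ring
  · have h1 := abs_unitDrift_mul_steinSolution_sub_le a hs hz.1 hz.2 hx
    rw [Real.norm_eq_abs, hc, abs_sub_comm]
    convert h1 using 2
    ring

/-! ### Stationarity, detailed balance, existence and uniqueness. -/

section Stationarity

variable {lam mu : ℝ} {n : ℕ} {π : Measure ℕ}

/-- Detailed balance for the birth-and-death chain. -/
def IsBalanced (lam mu : ℝ) (n : ℕ) (π : Measure ℕ) : Prop :=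
  ∀ k : ℕ, lam * π.real {k} = departureRate mu n (k + 1) * π.real {k + 1}

theorem hasSum_real_singleton_mul [IsFiniteMeasure π] {g : ℕ → ℝ} (hg : Integrable g π) :
    HasSum (fun k => π.real {k} * g k) (∫ k, g k ∂π) := by
  have h := hasSum_integral_iUnion (μ := π) (f := g) (s := fun k : ℕ => ({k} : Set ℕ))
    (fun k => measurableSet_singleton k) (fun i j hij => by simpa using hij)
    hg.integrableOn
  rw [iUnion_of_singleton, setIntegral_univ] at h
  simpa only [integral_singleton, smul_eq_mul] using h

theorem integrable_of_abs_le [IsFiniteMeasure π] {g : ℕ → ℝ} {C : ℝ} (hg : ∀ k, |g k| ≤ C) :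
    Integrable g π :=
  Integrable.of_bound (measurable_of_countable g).aestronglyMeasurable C
    (Eventually.of_forall hg)

theorem hasSum_real_singleton [IsProbabilityMeasure π] : HasSum (fun k => π.real {k}) 1 := by
  simpa using hasSum_real_singleton_mul (π := π) (g := fun _ => 1) (integrable_const _)

theorem departureRate_zero : departureRate mu n 0 = 0 := by simp [departureRate]

theorem abs_departureRate_le (k : ℕ) : |departureRate mu n k| ≤ |mu| * n := by
  unfold departureRate
  rw [abs_mul, abs_of_nonneg (Nat.cast_nonneg (α := ℝ) (min k n))]
  gcongr
  exact min_le_right k n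

theorem abs_birth_sub_death_le {g : ℕ → ℝ} {C : ℝ} (hg : ∀ k, |g k| ≤ C) (k : ℕ) :
    |lam * g (k + 1) - departureRate mu n k * g k| ≤ |lam| * C + |mu| * n * C := by
  refine (abs_sub _ _).trans ?_
  rw [abs_mul, abs_mul]
  have := abs_departureRate_le (mu := mu) (n := n) k
  gcongr
  · exact hg _
  · exact hg _

/-- The basic adjoint relation of the chain, in first-difference form. -/
theorem IsBalanced.integral_eq_zero [IsProbabilityMeasure π] (hb : IsBalanced lam mu n π)
    {g : ℕ → ℝ} {C : ℝ} (hg : ∀ k, |g k| ≤ C) :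
    ∫ k, (lam * g (k + 1) - departureRate mu n k * g k) ∂π = 0 := by
  have hs := hasSum_real_singleton_mul (π := π)
    (integrable_of_abs_le (abs_birth_sub_death_le (lam := lam) (mu := mu) (n := n) hg))
  refine tendsto_nhds_unique hs.tendsto_sum_nat ?_
  -- Detailed balance makes the series telescope: its partial sums are `u N`, which tend to 0 with
  -- the state probabilities.
  set u : ℕ → ℝ := fun k => departureRate mu n k * π.real {k} * g k with hu
  have hterm (k : ℕ) : π.real {k} * (lam * g (k + 1) - departureRate mu n k * g k) =
      u (k + 1) - u k := by
    simp only [hu]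
    rw [← hb k]
    ring
  have hsum (N : ℕ) : ∑ k ∈ Finset.range N,
      π.real {k} * (lam * g (k + 1) - departureRate mu n k * g k) = u N := by
    rw [Finset.sum_congr rfl fun k _ => hterm k, Finset.sum_range_sub]
    simp [hu, departureRate_zero]
  simp_rw [hsum]
  have h0 : Tendsto (fun k => |mu| * n * C * π.real {k}) atTop (𝓝 0) := by
    simpa using (hasSum_real_singleton (π := π)).summable.tendsto_atTop_zero.const_mul
      (|mu| * n * C)
  refine squeeze_zero_norm (fun k => ?_) h0
  rw [Real.norm_eq_abs, hu]
  simp only [abs_mul, abs_of_nonneg (measureReal_nonneg (μ := π) (s := {k}))]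
  have h1 := abs_departureRate_le (mu := mu) (n := n) k
  calc _ = |departureRate mu n k| * |g k| * π.real {k} := by ring
    _ ≤ _ := by gcongr; exact hg k

theorem generator_apply (f : ℕ →ᵇ ℝ) (k : ℕ) :
    generator lam mu n f k = generatorFun lam mu n f k := rfl

theorem stateIndicator_apply (j i : ℕ) : stateIndicator j i = if i = j then 1 else 0 := rfl

theorem IsBalanced.integral_generator [IsProbabilityMeasure π] (hb : IsBalanced lam mu n π)
    (f : ℕ →ᵇ ℝ) : ∫ k, generator lam mu n f k ∂π = 0 := by
  -- At k = 0 truncated subtraction makes this difference 0, matching the zero departure rate.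
  have h := hb.integral_eq_zero (g := fun k => f k - f (k - 1)) (C := 2 * ‖f‖) fun k => by
    simpa [Real.dist_eq] using f.dist_le_two_norm k (k - 1)
  rw [← h]
  refine integral_congr_ae (Eventually.of_forall fun k => ?_)
  simp only [generator_apply, generatorFun, Nat.add_sub_cancel]
  ring

/-- Expectation with respect to `π` as a bounded functional on bounded functions. -/
def expectation (π : Measure ℕ) [IsProbabilityMeasure π] : (ℕ →ᵇ ℝ) →L[ℝ] ℝ :=
  LinearMap.mkContinuous
    { toFun := fun f => ∫ k, f k ∂π
      map_add' := fun f g => integral_add (f.integrable π) (g.integrable π)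
      map_smul' := fun c f => integral_const_mul c f }
    1 (fun f => by simpa using f.norm_integral_le_norm (μ := π))

theorem expectation_apply [IsProbabilityMeasure π] (f : ℕ →ᵇ ℝ) :
    expectation π f = ∫ k, f k ∂π := rfl

/-- The generator stands outermost so that `IsBalanced.integral_generator` applies at every time t.
-/
theorem hasDerivAt_expectation_semigroup [IsProbabilityMeasure π] (f : ℕ →ᵇ ℝ) (t : ℝ) :
    HasDerivAt (fun t => expectation π (semigroup lam mu n t f))
      (expectation π (generator lam mu n (semigroup lam mu n t f))) t := by
  have h := hasDerivAt_exp_smul_const' (𝕂 := ℝ) (generator lam mu n) t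
  have h2 := h.clm_apply (hasDerivAt_const t f)
  rw [map_zero, add_zero] at h2
  exact (expectation π).hasFDerivAt.comp_hasDerivAt t h2

theorem semigroup_zero : semigroup lam mu n 0 = 1 := by
  simp [semigroup, expSemigroup]

theorem integral_stateIndicator [IsProbabilityMeasure π] (j : ℕ) :
    ∫ k, stateIndicator j k ∂π = π.real {j} := by
  have h := hasSum_real_singleton_mul ((stateIndicator j).integrable π)
  refine h.unique ?_
  convert hasSum_ite_eq j (π.real {j}) using 2 with k
  rw [stateIndicator_apply]
  split_ifs with hk <;> simp [hk]

theorem IsBalanced.isStationary [IsProbabilityMeasure π] (hb : IsBalanced lam mu n π) :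
    IsStationary lam mu n π := by
  refine ⟨inferInstance, fun t _ j => ?_⟩
  have hc (t : ℝ) : expectation π (semigroup lam mu n t (stateIndicator j)) =
      expectation π (stateIndicator j) := by
    have hd (t : ℝ) : HasDerivAt
        (fun t => expectation π (semigroup lam mu n t (stateIndicator j))) 0 t :=
      (hasDerivAt_expectation_semigroup _ t).congr_deriv (hb.integral_generator _)
    rw [is_const_of_deriv_eq_zero (fun t => (hd t).differentiableAt) (fun t => (hd t).deriv) t 0,
      semigroup_zero]
    rfl
  have h := hasSum_real_singleton_mul
    ((semigroup lam mu n t (stateIndicator j)).integrable π)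
  rw [← expectation_apply, hc, expectation_apply, integral_stateIndicator] at h
  exact h

theorem IsStationary.integral_generator_stateIndicator (h : IsStationary lam mu n π) (j : ℕ) :
    ∫ k, generator lam mu n (stateIndicator j) k ∂π = 0 := by
  have := h.isProbabilityMeasure
  have hd := hasDerivAt_expectation_semigroup (π := π) (lam := lam) (mu := mu) (n := n)
    (stateIndicator j) 0
  have hc (t : ℝ) (ht : t ∈ Ici (0 : ℝ)) :
      expectation π (semigroup lam mu n t (stateIndicator j)) = π.real {j} :=
    (hasSum_real_singleton_mul ((semigroup lam mu n t (stateIndicator j)).integrable π)).unique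
      (h.invariant t ht j)
  have h1 : HasDerivWithinAt
      (fun t => expectation π (semigroup lam mu n t (stateIndicator j))) 0 (Ici 0) 0 :=
    (hasDerivWithinAt_const 0 (Ici (0 : ℝ)) (π.real {j})).congr hc (hc 0 self_mem_Ici)
  -- Invariance is known only for t ≥ 0, so two derivatives at 0 within `Ici 0` are compared.
  have h2 := (uniqueDiffOn_Ici (0 : ℝ) 0 self_mem_Ici).eq_deriv _ hd.hasDerivWithinAt h1
  rw [semigroup_zero] at h2
  exact h2

theorem generator_stateIndicator_zero :
    generator lam mu n (stateIndicator 0) =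
      departureRate mu n 1 • stateIndicator 1 - lam • stateIndicator 0 := by
  ext k
  simp only [generator_apply, generatorFun, BoundedContinuousFunction.sub_apply,
    BoundedContinuousFunction.smul_apply, stateIndicator_apply, smul_eq_mul]
  rcases k with _ | _ | k <;> simp [departureRate_zero]

theorem generator_stateIndicator_succ (j : ℕ) :
    generator lam mu n (stateIndicator (j + 1)) =
      lam • stateIndicator j + departureRate mu n (j + 2) • stateIndicator (j + 2) -
        (lam + departureRate mu n (j + 1)) • stateIndicator (j + 1) := by
  ext k
  simp only [generator_apply, generatorFun, BoundedContinuousFunction.sub_apply,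
    BoundedContinuousFunction.add_apply,
    BoundedContinuousFunction.smul_apply, stateIndicator_apply, smul_eq_mul]
  rcases k with _ | k
  · by_cases h : j = 0 <;> simp [departureRate_zero, h, eq_comm]
  · by_cases h1 : k = j
    · subst h1; simp; ring
    · by_cases h2 : k = j + 1
      · subst h2; simp
      · by_cases h3 : k + 1 = j
        · simp [h3]
        · have : k + 1 + 1 ≠ j + 1 := by omega
          simp [h1, h2, h3]

/-- Integrating the generator of each state indicator gives global balance; subtracting detailed
balance at the previous state leaves it at the next. -/
theorem IsStationary.isBalanced (h : IsStationary lam mu n π) : IsBalanced lam mu n π := by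
  have := h.isProbabilityMeasure
  intro k
  induction k with
  | zero =>
    have h1 : expectation π _ = 0 := h.integral_generator_stateIndicator 0
    rw [generator_stateIndicator_zero, map_sub, map_smul, map_smul, expectation_apply,
      expectation_apply, integral_stateIndicator, integral_stateIndicator] at h1
    simp only [smul_eq_mul] at h1
    simp only [zero_add]
    linarith
  | succ j ih =>
    have h1 : expectation π _ = 0 := h.integral_generator_stateIndicator (j + 1)
    rw [generator_stateIndicator_succ, map_sub, map_add, map_smul, map_smul, map_smul,
      expectation_apply, expectation_apply, expectation_apply, integral_stateIndicator,
      integral_stateIndicator, integral_stateIndicator] at h1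
    simp only [smul_eq_mul] at h1
    linarith

theorem departureRate_pos (hn : 1 ≤ n) (hmu : 0 < mu) (k : ℕ) :
    0 < departureRate mu n (k + 1) := by
  have : 0 < min (k + 1) n := by omega
  unfold departureRate
  positivity

/-- The unnormalized stationary probabilities. -/
def stateWeight (lam mu : ℝ) (n : ℕ) : ℕ → ℝ
  | 0 => 1
  | k + 1 => lam / departureRate mu n (k + 1) * stateWeight lam mu n k

theorem stateWeight_pos (hn : 1 ≤ n) (hlam : 0 < lam) (hmu : 0 < mu) (k : ℕ) :
    0 < stateWeight lam mu n k := by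
  induction k with
  | zero => exact one_pos
  | succ k ih => exact mul_pos (div_pos hlam (departureRate_pos hn hmu k)) ih

theorem summable_stateWeight (hn : 1 ≤ n) (hlam : 0 < lam) (hmu : 0 < mu)
    (hRn : lam / mu < n) : Summable (stateWeight lam mu n) := by
  have hn' : (0 : ℝ) < n := by exact_mod_cast hn
  refine summable_of_ratio_test_tendsto_lt_one (l := lam / (mu * n)) ?_
    (Eventually.of_forall fun k => (stateWeight_pos hn hlam hmu k).ne') ?_
  · rw [div_lt_one (by positivity)]
    rwa [div_lt_iff₀ hmu, mul_comm] at hRn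
  -- With all n servers busy the ratio is exactly `lam / (mu * n)`.
  · refine tendsto_const_nhds.congr' ?_
    filter_upwards [eventually_ge_atTop n] with k hk
    have hmin : min (k + 1) n = n := by omega
    have h0 := stateWeight_pos hn hlam hmu k
    rw [stateWeight, Real.norm_of_nonneg (mul_pos (div_pos hlam (departureRate_pos hn hmu k))
      h0).le, Real.norm_of_nonneg h0.le, mul_div_cancel_right₀ _ h0.ne', departureRate, hmin]

theorem IsBalanced.real_singleton (hn : 1 ≤ n) (hmu : 0 < mu) (hb : IsBalanced lam mu n π)
    (k : ℕ) : π.real {k} = stateWeight lam mu n k * π.real {0} := by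
  induction k with
  | zero => simp [stateWeight]
  | succ k ih =>
    have h := departureRate_pos hn hmu k
    rw [stateWeight, mul_assoc, ← ih, div_mul_eq_mul_div, hb k, mul_div_cancel_left₀ _ h.ne']

theorem IsBalanced.unique {π' : Measure ℕ} [IsProbabilityMeasure π] [IsProbabilityMeasure π']
    (hn : 1 ≤ n) (hmu : 0 < mu) (hb : IsBalanced lam mu n π) (hb' : IsBalanced lam mu n π') :
    π = π' := by
  have h1 := (hasSum_real_singleton (π := π)).tsum_eq
  have h2 := (hasSum_real_singleton (π := π')).tsum_eq
  rw [tsum_congr (hb.real_singleton hn hmu), tsum_mul_right] at h1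
  rw [tsum_congr (hb'.real_singleton hn hmu), tsum_mul_right] at h2
  have h0 : π.real {0} = π'.real {0} := by
    refine mul_left_cancel₀ (left_ne_zero_of_mul_eq_one h1) (h1.trans h2.symm)
  refine Measure.ext_of_singleton fun k => ?_
  refine (ENNReal.toReal_eq_toReal_iff' (measure_ne_top _ _) (measure_ne_top _ _)).1 ?_
  change π.real {k} = π'.real {k}
  rw [hb.real_singleton hn hmu, hb'.real_singleton hn hmu, h0]

theorem exists_isBalanced (hn : 1 ≤ n) (hlam : 0 < lam) (hmu : 0 < mu) (hRn : lam / mu < n) :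
    ∃ π : Measure ℕ, IsProbabilityMeasure π ∧ IsBalanced lam mu n π := by
  set w := stateWeight lam mu n with hw
  have hs : Summable w := summable_stateWeight hn hlam hmu hRn
  have hw0 (k : ℕ) : 0 < w k := stateWeight_pos hn hlam hmu k
  have hZ : 0 < ∑' k, w k := hs.tsum_pos (fun k => (hw0 k).le) 0 (hw0 0)
  have hq (k : ℕ) : 0 ≤ w k / ∑' k, w k := (div_pos (hw0 k) hZ).le
  have h1 : ∑' k, ENNReal.ofReal (w k / ∑' k, w k) = 1 := by
    rw [← ENNReal.ofReal_tsum_of_nonneg hq (hs.div_const _), tsum_div_const, div_self hZ.ne',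
      ENNReal.ofReal_one]
  let p : PMF ℕ := ⟨fun k => ENNReal.ofReal (w k / ∑' k, w k), h1 ▸ ENNReal.summable.hasSum⟩
  have hp (k : ℕ) : p.toMeasure.real {k} = w k / ∑' k, w k := by
    rw [Measure.real, p.toMeasure_apply_singleton k (measurableSet_singleton k)]
    exact ENNReal.toReal_ofReal (hq k)
  refine ⟨p.toMeasure, inferInstance, fun k => ?_⟩
  have h := (departureRate_pos hn hmu k).ne'
  rw [hp, hp, hw, stateWeight]
  field_simp

theorem existsUnique_isStationary (hn : 1 ≤ n) (hlam : 0 < lam) (hmu : 0 < mu)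
    (hRn : lam / mu < n) : ∃! π : Measure ℕ, IsStationary lam mu n π := by
  obtain ⟨π, hπ, hb⟩ := exists_isBalanced hn hlam hmu hRn
  refine ⟨π, hb.isStationary, fun π' h' => ?_⟩
  have := h'.isProbabilityMeasure
  exact h'.isBalanced.unique hn hmu hb

end Stationarity

/-! ### Moments of the chain's drift and a bound on its atoms. -/

section Moments

variable {R mu : ℝ} {n : ℕ} {π : Measure ℕ}

theorem abs_sub_min_le (hR : 0 < R) (k : ℕ) : |R - (min k n : ℕ)| ≤ R + n := by
  have h1 : ((min k n : ℕ) : ℝ) ≤ n := by exact_mod_cast min_le_right k n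
  have h2 : (0 : ℝ) ≤ (min k n : ℕ) := Nat.cast_nonneg _
  rw [abs_le]
  constructor <;> linarith

theorem IsBalanced.integral_stein [IsProbabilityMeasure π] (hmu : 0 < mu)
    (hb : IsBalanced (R * mu) mu n π) {g : ℕ → ℝ} {C : ℝ} (hg : ∀ k, |g k| ≤ C) :
    ∫ k, (R * (g (k + 1) - g k) + (R - (min k n : ℕ)) * g k) ∂π = 0 := by
  have h := hb.integral_eq_zero hg
  have h2 : ∫ k, (R * mu * g (k + 1) - departureRate mu n k * g k) ∂π =
      mu * ∫ k, (R * (g (k + 1) - g k) + (R - (min k n : ℕ)) * g k) ∂π := by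
    rw [← integral_const_mul]
    refine integral_congr_ae (Eventually.of_forall fun k => ?_)
    simp only [departureRate]
    ring
  rw [h2] at h
  exact (mul_eq_zero.1 h).resolve_left hmu.ne'

/-- Test function g(k) = R - min(k,n): its increments are at least -1, so the Stein identity yields
E[g²] - R ≤ 0. -/
theorem IsBalanced.integral_sq_le [IsProbabilityMeasure π] (hmu : 0 < mu) (hR : 0 < R)
    (hb : IsBalanced (R * mu) mu n π) : ∫ k, (R - (min k n : ℕ)) ^ 2 ∂π ≤ R := by
  have h := hb.integral_stein hmu (g := fun k => R - (min k n : ℕ)) (abs_sub_min_le hR)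
  have hsq : Integrable (fun k : ℕ => (R - (min k n : ℕ)) ^ 2) π :=
    integrable_of_abs_le (C := (R + n) ^ 2) fun k => by
      rw [abs_pow]
      exact pow_le_pow_left₀ (abs_nonneg _) (abs_sub_min_le hR k) 2
  have hle : ∫ k, (R - (min k n : ℕ)) ^ 2 - R ∂π ≤
      ∫ k, (R * ((R - (min (k + 1) n : ℕ)) - (R - (min k n : ℕ))) +
        (R - (min k n : ℕ)) * (R - (min k n : ℕ))) ∂π := by
    refine integral_mono (hsq.sub (integrable_const _))
      (integrable_of_abs_le (C := R * (2 * (R + n)) + (R + n) * (R + n)) fun k => ?_)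
      fun k => ?_
    · have h1 := abs_sub_min_le (n := n) hR k
      have h2 := abs_sub_min_le (n := n) hR (k + 1)
      refine (abs_add_le _ _).trans ?_
      rw [abs_mul, abs_mul, abs_of_pos hR]
      gcongr
      refine (abs_sub _ _).trans ?_
      linarith
    · have h1 : ((min (k + 1) n : ℕ) : ℝ) ≤ (min k n : ℕ) + 1 := by
        exact_mod_cast (by omega : min (k + 1) n ≤ min k n + 1)
      simp only
      nlinarith
  rw [h, integral_sub hsq (integrable_const _)] at hle
  simp at hle
  simpa using hle

theorem IsBalanced.integral_abs_le [IsProbabilityMeasure π] (hmu : 0 < mu) (hR : 0 < R)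
    (hb : IsBalanced (R * mu) mu n π) : ∫ k, |R - (min k n : ℕ)| ∂π ≤ √R := by
  have hsR := Real.sqrt_pos.2 hR
  have hsq : Integrable (fun k : ℕ => (R - (min k n : ℕ)) ^ 2) π :=
    integrable_of_abs_le (C := (R + n) ^ 2) fun k => by
      rw [abs_pow]
      exact pow_le_pow_left₀ (abs_nonneg _) (abs_sub_min_le hR k) 2
  have habs : Integrable (fun k : ℕ => |R - (min k n : ℕ)|) π :=
    integrable_of_abs_le (C := R + n) fun k => by
      rw [abs_abs]; exact abs_sub_min_le hR k
  have hle : ∫ k, 2 * √R * |R - (min k n : ℕ)| ∂π ≤ ∫ k, ((R - (min k n : ℕ)) ^ 2 + R) ∂π := by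
    refine integral_mono (habs.const_mul _) (hsq.add (integrable_const _)) fun k => ?_
    have := sq_nonneg (|R - (min k n : ℕ)| - √R)
    have h2 := Real.sq_sqrt hR.le
    have h3 := sq_abs (R - (min k n : ℕ))
    simp only
    nlinarith
  rw [integral_const_mul, integral_add hsq (integrable_const _)] at hle
  simp only [integral_const, probReal_univ, one_smul] at hle
  have := hb.integral_sq_le hmu hR
  have h2 := Real.mul_self_sqrt hR.le
  nlinarith

/-- The increment of 1{k ≥ j+1} is the indicator of j, so R π{j} is at most E|R - min(X,n)| ≤ √R. -/
theorem IsBalanced.real_singleton_mul_sqrt_le [IsProbabilityMeasure π] (hmu : 0 < mu)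
    (hR : 0 < R) (hb : IsBalanced (R * mu) mu n π) (j : ℕ) : π.real {j} * √R ≤ 1 := by
  have h := hb.integral_stein hmu (g := fun k => if j + 1 ≤ k then 1 else 0) (C := 1)
    (fun k => by split_ifs <;> simp)
  have hle : R * π.real {j} ≤ ∫ k, |R - (min k n : ℕ)| ∂π := by
    have habs : Integrable (fun k : ℕ => |R - (min k n : ℕ)|) π :=
      integrable_of_abs_le (C := R + n) fun k => by
        rw [abs_abs]; exact abs_sub_min_le hR k
    have hi : Integrable (fun k => R * stateIndicator j k) π :=
      ((stateIndicator j).integrable π).const_mul R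
    have h3 : ∫ k, (R * stateIndicator j k - |R - (min k n : ℕ)|) ∂π ≤ 0 := by
      rw [← h]
      refine integral_mono (hi.sub habs)
        (integrable_of_abs_le (C := R * 2 + (R + n) * 1) fun k => ?_) fun k => ?_
      · have h1 := abs_sub_min_le (n := n) hR k
        refine (abs_add_le _ _).trans ?_
        rw [abs_mul, abs_mul, abs_of_pos hR]
        gcongr
        · split_ifs <;> norm_num
        · split_ifs <;> norm_num
      · have h1 := neg_abs_le (R - (min k n : ℕ))
        have h2 := abs_nonneg (R - (min k n : ℕ))
        simp only [stateIndicator_apply]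
        rcases lt_trichotomy k j with hk | rfl | hk
        · rw [if_neg hk.ne, if_neg (by omega), if_neg (by omega)]
          linarith
        · rw [if_pos rfl, if_pos le_rfl, if_neg (by omega)]
          linarith
        · rw [if_neg hk.ne', if_pos (by omega), if_pos (by omega)]
          linarith
    rw [integral_sub hi habs, integral_const_mul, integral_stateIndicator] at h3
    linarith
  have h2 := hb.integral_abs_le hmu hR
  have h3 := Real.mul_self_sqrt hR.le
  have h4 := Real.sqrt_pos.2 hR
  have h5 : √R * (π.real {j} * √R) ≤ √R * 1 := by
    calc _ = √R * √R * π.real {j} := by ring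
      _ ≤ _ := by rw [h3]; linarith
  exact le_of_mul_le_mul_left h5 h4

end Moments

/-! ### The limit law in terms of the unit-rate density. -/

section Diffusion

variable {lam mu : ℝ} {n : ℕ}

theorem zeta_neg (hR : 0 < offeredLoad lam mu) (hRn : offeredLoad lam mu < n) :
    zeta lam mu n < 0 :=
  div_neg_of_neg_of_pos (by linarith) (Real.sqrt_pos.2 hR)

theorem drift_eq (hz : zeta lam mu n < 0) (x : ℝ) :
    drift lam mu n x = unitDrift (-zeta lam mu n) x * mu := by
  rw [drift, unitDrift, max_eq_left (by linarith : (0 : ℝ) ≤ -zeta lam mu n),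
    ← max_sub_sub_right]
  congr 2 <;> ring

theorem weight_eq (hmu : 0 < mu) (hz : zeta lam mu n < 0) :
    weight lam mu n = unitWeight (-zeta lam mu n) := by
  ext x
  rw [weight, unitWeight]
  congr 1
  simp_rw [drift_eq hz]
  rw [intervalIntegral.integral_mul_const]
  field_simp

theorem diffusionLaw_apply (hmu : 0 < mu) (hz : zeta lam mu n < 0) {S : Set ℝ}
    (hS : MeasurableSet S) : diffusionLaw lam mu n S = ENNReal.ofReal
      ((∫ y in S, unitWeight (-zeta lam mu n) y) / totalMass (-zeta lam mu n)) := by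
  have hs : 0 < -zeta lam mu n := by linarith
  have hi := integrable_unitWeight hs
  have hd (x : ℝ) : density lam mu n x =
      (totalMass (-zeta lam mu n))⁻¹ * unitWeight (-zeta lam mu n) x := by
    rw [density, weight_eq hmu hz, totalMass]
  simp_rw [diffusionLaw, hd]
  rw [withDensity_apply _ hS,
    ← ofReal_integral_eq_lintegral_ofReal (hi.const_mul _).integrableOn, integral_const_mul,
    div_eq_inv_mul]
  exact Eventually.of_forall fun x =>
    mul_nonneg (inv_nonneg.2 (totalMass_pos hs).le) (unitWeight_pos _ x).le

theorem isProbabilityMeasure_diffusionLaw (hmu : 0 < mu) (hz : zeta lam mu n < 0) :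
    IsProbabilityMeasure (diffusionLaw lam mu n) := by
  refine ⟨?_⟩
  have := totalMass_pos (s := -zeta lam mu n) (by linarith)
  rw [diffusionLaw_apply hmu hz MeasurableSet.univ, setIntegral_univ, ← totalMass,
    div_self this.ne', ENNReal.ofReal_one]

theorem diffusionLaw_real_Iic (hmu : 0 < mu) (hz : zeta lam mu n < 0) (a : ℝ) :
    (diffusionLaw lam mu n).real (Iic a) = limitCDF (-zeta lam mu n) a := by
  rw [Measure.real, diffusionLaw_apply hmu hz measurableSet_Iic]
  exact ENNReal.toReal_ofReal (limitCDF_nonneg a (by linarith : 0 < -zeta lam mu n))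

end Diffusion

/-! ### Comparison of the chain with the diffusion. -/

section Comparison

/-- The state `k` of the chain on the diffusion scale. -/
def scaledState (R : ℝ) (k : ℕ) : ℝ := (k - R) / √R

variable {R mu : ℝ} {n : ℕ} {π : Measure ℕ}

theorem scaledState_succ (R : ℝ) (k : ℕ) :
    scaledState R (k + 1) = scaledState R k + 1 / √R := by
  rw [scaledState, scaledState, ← add_div]
  push_cast
  ring

theorem monotone_scaledState (R : ℝ) : Monotone (scaledState R) := fun i j h => by
  have : (i : ℝ) ≤ j := by exact_mod_cast h
  unfold scaledState
  gcongr

theorem unitDrift_scaledState (R : ℝ) (k n : ℕ) :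
    unitDrift (scaledState R n) (scaledState R k) = (R - (min k n : ℕ)) / √R := by
  rcases le_total k n with h | h
  · rw [unitDrift_of_le (monotone_scaledState R h), min_eq_left h, scaledState]
    ring
  · rw [unitDrift_of_ge (monotone_scaledState R h), min_eq_right h, scaledState]
    ring

/-- At most one step straddles a; naming its state allows the atom bound to be applied. -/
theorem eq_floor_of_straddle (hR : 0 < R) {a : ℝ} {k : ℕ} (h1 : scaledState R k ≤ a)
    (h2 : a < scaledState R (k + 1)) : k = ⌊R + a * √R⌋₊ := by
  have hs := Real.sqrt_pos.2 hR
  rw [scaledState, div_le_iff₀ hs] at h1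
  rw [scaledState, lt_div_iff₀ hs] at h2
  push_cast at h2
  symm
  rw [Nat.floor_eq_iff (by linarith [Nat.cast_nonneg (α := ℝ) k])]
  constructor <;> linarith

/-- The error of the first-order expansion of the Stein solution at the state `k`. -/
def steinError (R : ℝ) (n : ℕ) (a : ℝ) (k : ℕ) : ℝ :=
  (if scaledState R k ≤ a then 1 else 0) - limitCDF (scaledState R n) a -
    unitDrift (scaledState R n) (scaledState R k) *
      steinSolution (scaledState R n) a (scaledState R k) -
    √R * (steinSolution (scaledState R n) a (scaledState R (k + 1)) -
      steinSolution (scaledState R n) a (scaledState R k))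

theorem scaledState_pos (hR : 0 < R) (hRn : R < n) : 0 < scaledState R n :=
  div_pos (by linarith) (Real.sqrt_pos.2 hR)

theorem abs_steinError_le (hR : 0 < R) (hRn : R < n) (a : ℝ) (k : ℕ) :
    |steinError R n a k| ≤
      (9 + 2 * (|R - (min k n : ℕ)| / √R)) / √R + 4 * stateIndicator ⌊R + a * √R⌋₊ k := by
  have hr := Real.sqrt_pos.2 hR
  have hs := scaledState_pos hR hRn
  have hβ : |unitDrift (scaledState R n) (scaledState R k)| = |R - (min k n : ℕ)| / √R := by
    rw [unitDrift_scaledState, abs_div, abs_of_pos hr]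
  have hind : 0 ≤ stateIndicator ⌊R + a * √R⌋₊ k := by
    rw [stateIndicator_apply]; split_ifs <;> norm_num
  have hmain (i : ℝ) (hi : (if scaledState R k ≤ a then (1 : ℝ) else 0) = i)
      (h : i = 1 ∧ scaledState R k + 1 / √R ≤ a ∨ i = 0 ∧ a ≤ scaledState R k) :
      |steinError R n a k| ≤ (9 + 2 * (|R - (min k n : ℕ)| / √R)) / √R := by
    -- The kink of the drift is the scaled state of n, so no step straddles it.
    have hgrid : scaledState R k + 1 / √R ≤ scaledState R n ∨
        scaledState R n ≤ scaledState R k := by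
      rw [← scaledState_succ]
      rcases lt_or_ge k n with h | h
      · exact Or.inl (monotone_scaledState R h)
      · exact Or.inr (monotone_scaledState R h)
    have ht := abs_steinSolution_taylor_le a hs (by positivity) hgrid h
    rw [hβ, ← scaledState_succ] at ht
    have he : steinError R n a k = -√R *
        (steinSolution (scaledState R n) a (scaledState R (k + 1)) -
          steinSolution (scaledState R n) a (scaledState R k) -
          (i - limitCDF (scaledState R n) a - unitDrift (scaledState R n) (scaledState R k) *
            steinSolution (scaledState R n) a (scaledState R k)) * (1 / √R)) := by
      rw [steinError, hi]
      field_simp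
      ring
    rw [he, abs_mul, abs_neg, abs_of_pos hr]
    refine (mul_le_mul_of_nonneg_left ht hr.le).trans (le_of_eq ?_)
    field_simp
  rcases le_or_gt (scaledState R (k + 1)) a with h1 | h1
  · have h2 := (monotone_scaledState R k.le_succ).trans h1
    linarith [hmain 1 (if_pos h2) (Or.inl ⟨rfl, scaledState_succ R k ▸ h1⟩)]
  · rcases lt_or_ge a (scaledState R k) with h2 | h2
    · linarith [hmain 0 (if_neg h2.not_ge) (Or.inr ⟨rfl, h2.le⟩)]
    · rw [stateIndicator_apply, if_pos (eq_floor_of_straddle hR h2 h1)]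
      -- On the straddling step only |f'| ≤ 2 and the Lipschitz constant 2 are available, giving 4.
      have h3 : |steinError R n a k| ≤ 2 + √R * (2 * (1 / √R)) := by
        rw [steinError, if_pos h2]
        refine (abs_sub _ _).trans (add_le_add
          (abs_steinDeriv_le a hs zero_le_one le_rfl _) ?_)
        rw [abs_mul, abs_of_pos hr]
        have := abs_steinSolution_sub_le a hs (monotone_scaledState R k.le_succ)
        rw [Nat.succ_eq_add_one, scaledState_succ, add_sub_cancel_left, ← scaledState_succ] at this
        gcongr
      have h4 : √R * (2 * (1 / √R)) = 2 := by field_simp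
      have h5 : 0 ≤ (9 + 2 * (|R - (min k n : ℕ)| / √R)) / √R := by positivity
      linarith

theorem IsBalanced.abs_cdf_sub_le [IsProbabilityMeasure π] (hmu : 0 < mu) (hR : 0 < R)
    (hRn : R < n) (hb : IsBalanced (R * mu) mu n π) (a : ℝ) :
    |π.real {k | scaledState R k ≤ a} - limitCDF (scaledState R n) a| ≤ 15 / √R := by
  have hr := Real.sqrt_pos.2 hR
  have hs := scaledState_pos hR hRn
  set j := ⌊R + a * √R⌋₊
  set f : ℕ → ℝ := fun k => steinSolution (scaledState R n) a (scaledState R k) with hf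
  have hfb (k : ℕ) : |f k| ≤ max 9 (1 / scaledState R n) := by
    rw [abs_of_nonneg (steinSolution_nonneg a hs _)]
    exact steinSolution_le a hs _
  have hind : Integrable (fun k => if scaledState R k ≤ a then (1 : ℝ) else 0) π :=
    integrable_of_abs_le (C := 1) fun k => by split_ifs <;> simp
  have habs : Integrable (fun k : ℕ => |R - (min k n : ℕ)|) π :=
    integrable_of_abs_le (C := R + n) fun k => by
      rw [abs_abs]; exact abs_sub_min_le hR k
  have hbd : Integrable (fun k : ℕ => (9 + 2 * (|R - (min k n : ℕ)| / √R)) / √R) π :=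
    ((integrable_const _).add ((habs.div_const _).const_mul _)).div_const _
  have hsi : Integrable (fun k => 4 * stateIndicator j k) π :=
    ((stateIndicator j).integrable π).const_mul 4
  have hst : Integrable
      (fun k : ℕ => R * (f (k + 1) - f k) + (R - (min k n : ℕ)) * f k) π := by
    refine integrable_of_abs_le (C := R * (2 * max 9 (1 / scaledState R n)) +
      (R + n) * max 9 (1 / scaledState R n)) fun k => ?_
    refine (abs_add_le _ _).trans ?_
    rw [abs_mul, abs_mul, abs_of_pos hR]
    have h1 := abs_sub_min_le (n := n) hR k
    gcongr
    · exact (abs_sub _ _).trans (by linarith [hfb k, hfb (k + 1)])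
    · exact hfb k
  have hcen : Integrable (fun k =>
      (if scaledState R k ≤ a then (1 : ℝ) else 0) - limitCDF (scaledState R n) a) π :=
    hind.sub (integrable_const _)
  have herr (k : ℕ) : steinError R n a k =
      ((if scaledState R k ≤ a then 1 else 0) - limitCDF (scaledState R n) a) -
        (R * (f (k + 1) - f k) + (R - (min k n : ℕ)) * f k) / √R := by
    rw [steinError, unitDrift_scaledState, add_div, mul_div_right_comm R, Real.div_sqrt]
    simp only [hf]
    ring
  have hkey : ∫ k, steinError R n a k ∂π =
      π.real {k | scaledState R k ≤ a} - limitCDF (scaledState R n) a := by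
    simp_rw [herr]
    rw [integral_sub hcen (hst.div_const _), integral_div,
      hb.integral_stein hmu hfb, zero_div, sub_zero, integral_sub hind (integrable_const _)]
    have h1 : (fun k => if scaledState R k ≤ a then (1 : ℝ) else 0) =
        indicator {k | scaledState R k ≤ a} 1 := by
      ext k
      simp [indicator_apply]
    rw [h1, integral_indicator_one (Set.to_countable _).measurableSet]
    simp
  rw [← hkey]
  refine (norm_integral_le_of_norm_le (f := steinError R n a) (hbd.add hsi)
    (Eventually.of_forall fun k => abs_steinError_le hR hRn a k)).trans ?_
  rw [integral_add' hbd hsi, integral_const_mul, integral_stateIndicator, integral_div,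
    integral_add (integrable_const _) ((habs.div_const _).const_mul _), integral_const_mul,
    integral_div, integral_const, probReal_univ, one_smul]
  have h1 := (div_le_one hr).2 (hb.integral_abs_le hmu hR)
  have h2 := (le_div_iff₀ hr).2 (hb.real_singleton_mul_sqrt_le hmu hR j)
  -- The factor 1 bounds E|β|, and 4 is the straddling error weighted by an atom of mass at most
  -- 1/√R.
  calc _ ≤ (9 + 2 * 1) / √R + 4 * (1 / √R) := by gcongr
    _ = 15 / √R := by ring

end Comparison

end ErlangC

end

theorem theorem3 (n : ℕ) (lam mu : ℝ) (hn : 1 ≤ n) (hlam : 0 < lam) (hmu : 0 < mu)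
    (hR : 1 ≤ ErlangC.offeredLoad lam mu) (hRn : ErlangC.offeredLoad lam mu < n) :
    IsProbabilityMeasure (ErlangC.diffusionLaw lam mu n) ∧
    (∃! π : Measure ℕ, ErlangC.IsStationary lam mu n π) ∧
    ∀ π : Measure ℕ, ErlangC.IsStationary lam mu n π →
      ErlangC.kolmogorovDist (ErlangC.scaledLaw lam mu π) (ErlangC.diffusionLaw lam mu n) ≤
        188 / √(ErlangC.offeredLoad lam mu) := by
  have hR0 : 0 < ErlangC.offeredLoad lam mu := by linarith
  have hz := ErlangC.zeta_neg hR0 hRn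
  refine ⟨ErlangC.isProbabilityMeasure_diffusionLaw hmu hz,
    ErlangC.existsUnique_isStationary hn hlam hmu hRn, fun π hπ => ciSup_le fun a => ?_⟩
  have := hπ.isProbabilityMeasure
  have hlam' : ErlangC.offeredLoad lam mu * mu = lam := div_mul_cancel₀ lam hmu.ne'
  have hb : ErlangC.IsBalanced (ErlangC.offeredLoad lam mu * mu) mu n π :=
    hlam'.symm ▸ hπ.isBalanced
  have hs : -ErlangC.zeta lam mu n = ErlangC.scaledState (ErlangC.offeredLoad lam mu) n := by
    rw [ErlangC.zeta, ErlangC.scaledState]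
    ring
  have hmap : (ErlangC.scaledLaw lam mu π).real (Iic a) =
      π.real {k | ErlangC.scaledState (ErlangC.offeredLoad lam mu) k ≤ a} :=
    map_measureReal_apply (measurable_of_countable _) measurableSet_Iic
  rw [hmap, ErlangC.diffusionLaw_real_Iic hmu hz, hs]
  refine (hb.abs_cdf_sub_le hmu hR0 hRn a).trans ?_
  gcongr
  norm_num
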